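/- Let $I\subseteq\mathbb{R}$ be a nonempty open interval and let $\mathbb{R}_+$ be the set of positive reals. For a strictly monotone $f:I\to\mathbb{R}$ let $f^{(-1)}:\operatorname{conv}(f(I))\to I$ denote its generalized left inverse, i.e. the unique monotone function with $f^{(-1)}(f(x))=x$ for all $x\in I$. For $p=(p_1,\dots,p_n):I\to\mathbb{R}_+^n$, the $n$-variable generalized Bajraktarević mean $A_{f,p}:I^n\to I$ is $$A_{f,p}(x_1,\dots,x_n)=f^{(-1)}\left(\frac{p_1(x_1)f(x_1)+\dots+p_n(x_n)f(x_n)}{p_1(x_1)+\dots+p_n(x_n)}\right).$$ Let $\operatorname{diag}(I^n)=\{(t,\dots,t): t\in I\}$. **Theorem.** Let $n\ge 3$ and let $f,g:I\to\mathbb{R}$ be three times differentiable functions on $I$ with nonvanishing first derivatives (hence $f$ and $g$ are strictly monotone). Let $p=(p_1,\dots,p_n):I\to\mathbb{R}_+^n$ be continuous on $I$ and let $q=(q_1,\dots,q_n):I\to\mathbb{R}_+^n$ be arbitrary. Assume that $i,j,k\in\{1,\dots,n\}$ are pairwise distinct and that $p_i,p_j,p_k$ are differentiable on $I$. Then the following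 assertions are equivalent. 1. $A_{f,p}=A_{g,q}$ on $I^n$. 2. There is an open subset $U$ of $I^n$ containing $\operatorname{diag}(I^n)$ such that $A_{f,p}=A_{g,q}$ on $U$. 3. The function $q$ is continuous on $I$, the functions $q_i,q_j,q_k$ are differentiable on $I$, and the partial derivatives below exist and satisfy the following equalities at every point of $\operatorname{diag}(I^n)$: $$\partial_\ell A_{f,p}=\partial_\ell A_{g,q}\quad(\ell\in\{1,\dots,n-1\}),\qquad \partial_i\partial_jA_{f,p}=\partial_i\partial_jA_{g,q},\qquad \partial_i\partial_j\partial_kA_{f,p}=\partial_i\partial_j\partial_kA_{g,q}.$$ 4. There exist $a,b,c,d\in\mathbb{R}$ with $ad\ne bc$ such that, on $I$, $$g=\frac{af+b}{cf+d}\qquad\text{and}\qquad q_\ell=(cf+d)\,p_\ell\quad(\ell\in\{1,\dots,n\}).$$ -/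

import Mathlib

open Set Filter Topology

/-- `f` is `k` times differentiable on the (open) set `I`. -/
def TimesDifferentiableOn (k : ℕ) (f : ℝ → ℝ) (I : Set ℝ) : Prop :=
  ∀ m < k, DifferentiableOn ℝ (deriv^[m] f) I

/-- `g` is a monotone function `conv (f(I)) → I` (in either sense) which is a left inverse of
`f` on `I`.  Only the values of `f` on `I` and of `g` on `conv (f(I))` matter. -/
structure IsGenLeftInverse (I : Set ℝ) (f g : ℝ → ℝ) : Prop where
  monotone : MonotoneOn g (convexHull ℝ (f '' I)) ∨ AntitoneOn g (convexHull ℝ (f '' I))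
  mapsTo : MapsTo g (convexHull ℝ (f '' I)) I
  leftInv : ∀ x ∈ I, g (f x) = x

/-- A strictly monotone function on an interval has a generalized left inverse. -/
theorem exists_isGenLeftInverse {I : Set ℝ} (hI : I.OrdConnected) {f : ℝ → ℝ}
    (hf : StrictMonoOn f I ∨ StrictAntiOn f I) : ∃ g, IsGenLeftInverse I f g := by
  have key : ∀ h : ℝ → ℝ, StrictMonoOn h I → ∃ g, IsGenLeftInverse I h g ∧
      MonotoneOn g (convexHull ℝ (h '' I)) := by
    intro h hh
    have hC : convexHull ℝ (h '' I) ⊆ {y | (∃ a ∈ I, h a ≤ y) ∧ ∃ b ∈ I, y ≤ h b} := by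
      apply convexHull_min
      · rintro _ ⟨x, hx, rfl⟩
        exact ⟨⟨x, hx, le_rfl⟩, ⟨x, hx, le_rfl⟩⟩
      · apply OrdConnected.convex
        refine ⟨?_⟩
        rintro y ⟨⟨a, ha, hay⟩, -⟩ z ⟨-, ⟨b, hb, hzb⟩⟩ w ⟨hw1, hw2⟩
        exact ⟨⟨a, ha, hay.trans hw1⟩, ⟨b, hb, hw2.trans hzb⟩⟩
    have hbdd : ∀ y, ∀ b ∈ I, y ≤ h b → b ∈ upperBounds {u | u ∈ I ∧ h u ≤ y} := by
      rintro y b hb hyb u ⟨hu, huy⟩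
      exact (hh.le_iff_le hu hb).1 (huy.trans hyb)
    have hmono : MonotoneOn (fun y => sSup {u | u ∈ I ∧ h u ≤ y}) (convexHull ℝ (h '' I)) := by
      intro y hy z hz hyz
      obtain ⟨⟨a, ha, hay⟩, -⟩ := hC hy
      obtain ⟨-, ⟨b, hb, hzb⟩⟩ := hC hz
      exact csSup_le_csSup ⟨b, hbdd z b hb hzb⟩ ⟨a, ha, hay⟩
        (fun u hu => ⟨hu.1, hu.2.trans hyz⟩)
    refine ⟨fun y => sSup {u | u ∈ I ∧ h u ≤ y}, ⟨Or.inl hmono, ?_, ?_⟩, hmono⟩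
    · intro y hy
      obtain ⟨⟨a, ha, hay⟩, ⟨b, hb, hyb⟩⟩ := hC hy
      exact hI.out ha hb ⟨le_csSup ⟨b, hbdd y b hb hyb⟩ ⟨ha, hay⟩,
        csSup_le ⟨a, ha, hay⟩ (hbdd y b hb hyb)⟩
    · intro x hx
      exact IsGreatest.csSup_eq ⟨⟨hx, le_rfl⟩, hbdd (h x) x hx le_rfl⟩
  rcases hf with hf | hf
  · obtain ⟨g, hg, -⟩ := key f hf
    exact ⟨g, hg⟩
  · obtain ⟨g, hg, hm⟩ := key (fun x => -f x) (fun x hx y hy hxy => neg_lt_neg (hf hx hy hxy))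
    have hC : ∀ y ∈ convexHull ℝ (f '' I), -y ∈ convexHull ℝ ((fun x => -f x) '' I) := by
      intro y hy
      have h1 : (fun x => -f x) '' I = -(f '' I) := by
        rw [← Set.image_neg_eq_neg, Set.image_image]
      rw [h1, convexHull_neg]
      simpa using hy
    refine ⟨fun y => g (-y), ⟨Or.inr ?_, fun y hy => hg.mapsTo (hC y hy), hg.leftInv⟩⟩
    intro y hy z hz hyz
    exact hm (hC z hz) (hC y hy) (neg_le_neg hyz)

/-- The generalized left inverse of a strictly monotone function is uniquely determined on
`conv (f(I))`. -/
theorem IsGenLeftInverse.eqOn {I : Set ℝ} (hI : I.OrdConnected) {f g h : ℝ → ℝ}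
    (hf : StrictMonoOn f I ∨ StrictAntiOn f I)
    (hg : IsGenLeftInverse I f g) (hh : IsGenLeftInverse I f h) :
    EqOn g h (convexHull ℝ (f '' I)) := by
  have hC : ∀ x ∈ I, f x ∈ convexHull ℝ (f '' I) :=
    fun x hx => subset_convexHull ℝ _ (mem_image_of_mem f hx)
  have key : ∀ g h : ℝ → ℝ, IsGenLeftInverse I f g → IsGenLeftInverse I f h →
      ∀ y ∈ convexHull ℝ (f '' I), ¬ h y < g y := by
    intro g h hg hh y hy hlt
    have h1 := hh.mapsTo hy
    have h2 := hg.mapsTo hy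
    obtain ⟨u, hu1, hu2⟩ := exists_between hlt
    have hu : u ∈ I := hI.out h1 h2 ⟨hu1.le, hu2.le⟩
    have eg1 := hg.leftInv _ h1
    have eg2 := hg.leftInv _ h2
    have eh1 := hh.leftInv _ h1
    have eh2 := hh.leftInv _ h2
    have egu := hg.leftInv _ hu
    have ehu := hh.leftInv _ hu
    rcases hf with hf | hf
    · have hfl := (hf h1 h2 hlt).le
      rcases hg.monotone with mg | mg
      · rcases hh.monotone with mh | mh
        · rcases le_total (f u) y with hle | hle
          · have := mh (hC u hu) hy hle
            linarith
          · have := mg hy (hC u hu) hle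
            linarith
        · have := mh (hC _ h1) (hC _ h2) hfl
          linarith
      · have := mg (hC _ h1) (hC _ h2) hfl
        linarith
    · have hfl := (hf h1 h2 hlt).le
      rcases hg.monotone with mg | mg
      · have := mg (hC _ h2) (hC _ h1) hfl
        linarith
      · rcases hh.monotone with mh | mh
        · have := mh (hC _ h2) (hC _ h1) hfl
          linarith
        · rcases le_total (f u) y with hle | hle
          · have := mg (hC u hu) hy hle
            linarith
          · have := mh hy (hC u hu) hle
            linarith
  intro y hy
  exact le_antisymm (not_lt.1 (key g h hg hh y hy)) (not_lt.1 (key h g hh hg y hy))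

open Classical in
/-- The generalized left inverse `f⁽⁻¹⁾ : conv (f(I)) → I` of a strictly monotone function
`f : I → ℝ` (with no meaning outside `conv (f(I))`). -/
noncomputable def genLeftInverse (I : Set ℝ) (f : ℝ → ℝ) : ℝ → ℝ :=
  if h : ∃ g, IsGenLeftInverse I f g then h.choose else 0

theorem isGenLeftInverse_genLeftInverse {I : Set ℝ} (hI : I.OrdConnected) {f : ℝ → ℝ}
    (hf : StrictMonoOn f I ∨ StrictAntiOn f I) :
    IsGenLeftInverse I f (genLeftInverse I f) := by
  have h := exists_isGenLeftInverse hI hf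
  rw [genLeftInverse, dif_pos h]
  exact h.choose_spec

/-- The `n`-variable generalized Bajraktarević mean `A_{f,p}` on `Iⁿ`. -/
noncomputable def bajraktarevicMean {n : ℕ} (I : Set ℝ) (f : ℝ → ℝ) (p : Fin n → ℝ → ℝ)
    (x : Fin n → ℝ) : ℝ :=
  genLeftInverse I f ((∑ ℓ, p ℓ (x ℓ) * f (x ℓ)) / ∑ ℓ, p ℓ (x ℓ))

/-- The cube `Iⁿ`. -/
def cube (n : ℕ) (I : Set ℝ) : Set (Fin n → ℝ) := {x | ∀ ℓ, x ℓ ∈ I}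

/-- The diagonal of `Iⁿ`. -/
def cubeDiag (n : ℕ) (I : Set ℝ) : Set (Fin n → ℝ) := {x | ∃ t ∈ I, x = fun _ => t}

/-- The partial derivative `∂_i F`. -/
noncomputable def partialDeriv {n : ℕ} (i : Fin n) (F : (Fin n → ℝ) → ℝ)
    (x : Fin n → ℝ) : ℝ :=
  deriv (fun t => F (Function.update x i t)) (x i)

/-- The iterated partial derivative: for the list `[i₁, …, i_m]` it is `∂_{i₁} ⋯ ∂_{i_m} F`,
where `∂_{i_m}` is taken first. -/
noncomputable def iterPartialDeriv {n : ℕ} :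
    List (Fin n) → ((Fin n → ℝ) → ℝ) → (Fin n → ℝ) → ℝ
  | [], F => F
  | i :: L, F => partialDeriv i (iterPartialDeriv L F)

/-- The iterated partial derivative `∂_{i₁} ⋯ ∂_{i_m} F` exists at `x`: the inner derivative
`∂_{i₂} ⋯ ∂_{i_m} F` exists at the points near `x` on the line through `x` in the direction of the
`i₁`-th axis, and it is differentiable at `x` along this line. -/
def IterPartialDerivExists {n : ℕ} :
    List (Fin n) → ((Fin n → ℝ) → ℝ) → (Fin n → ℝ) → Prop
  | [], _, _ => True
  | i :: L, F, x =>
      (∀ᶠ t in 𝓝 (x i), IterPartialDerivExists L F (Function.update x i t)) ∧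
        DifferentiableAt ℝ (fun t => iterPartialDeriv L F (Function.update x i t)) (x i)

/-- `∂_{i₁} ⋯ ∂_{i_m} F` and `∂_{i₁} ⋯ ∂_{i_m} G` exist and are equal at every point of `S`. -/
def IterPartialDerivEqOn {n : ℕ} (L : List (Fin n)) (F G : (Fin n → ℝ) → ℝ)
    (S : Set (Fin n → ℝ)) : Prop :=
  ∀ x ∈ S, IterPartialDerivExists L F x ∧ IterPartialDerivExists L G x ∧
    iterPartialDeriv L F x = iterPartialDeriv L G x

/-!
The equivalence is proved along the cycle of the four assertions.

Since `f` and `g` have nonvanishing derivatives on an open interval, the generalized left inverse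
is an honest differentiable inverse on the interval `f(I)`, so that `A = A_{f,p}(x)` is the unique
point of `I` at which `f(A)` equals the weighted average of the values `f(x_ℓ)`
(`IsRegularGenerator.mean_spec`). This makes the step from the fractional linear form of `g` to
equality of the means a direct substitution (`IsRegularGenerator.mean_eqOn_of_fractional`).

If the means agree near the diagonal, the equation defining `A_{g,q}` can be solved for `q_ℓ` at
points `(t, …, s, …, t)` with `s ≠ t`. As `A_{g,q} = A_{f,p}` there, the weight `q_ℓ` inherits
the continuity or differentiability of `p_ℓ`
(`IsRegularGenerator.exists_weight_eventuallyEq`), and the partial derivatives of the two means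
exist and coincide.

For the converse direction the mixed partial derivatives in distinct variables are computed on
the whole cube (`meanD1`, `meanD2`, `meanD3`). On the diagonal, with `P = p₁ + ⋯ + pₙ`,
`m_ℓ = p_ℓ' / p_ℓ` and `φ = f'' / f'`, they are
* `∂_ℓ A = p_ℓ / P`,
* `∂_i ∂_j A = - (p_i p_j / P²) (m_i + m_j + φ)`,
* `∂_i ∂_j ∂_k A = (p_i p_j p_k / P³)
  (2 (m_i m_j + m_j m_k + m_i m_k) + 2 φ (m_i + m_j + m_k) + 2 φ² - φ')`.

Equality of the first derivatives gives `q_ℓ = r p_ℓ` with a common factor `r`. With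
`ψ = g'' / g'`, equality of the second ones gives `φ - ψ = 2 r' / r`; in particular `r` is twice
differentiable. Equality of the third ones then reduces to `r'' = φ r'`, that is
`(r' / f')' = 0`, whence `r = c f + d`. The same relations give `((g r)' / f')' = 0`, whence
`g r = a f + b` (`IsRegularGenerator.exists_fractional`), and `g' r² = (a d - b c) f'` shows that
`a d ≠ b c`.
-/

/-! ### Regular generators and their inverses -/

/-- A generator of a Bajraktarević mean with the regularity needed below: a three times
differentiable function with nonvanishing derivative on an open interval `I`. -/
structure IsRegularGenerator (I : Set ℝ) (f : ℝ → ℝ) : Prop where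
  isOpen : IsOpen I
  ordConnected : I.OrdConnected
  timesDifferentiableOn : TimesDifferentiableOn 3 f I
  deriv_ne_zero : ∀ x ∈ I, deriv f x ≠ 0

namespace IsRegularGenerator

variable {I : Set ℝ} {f : ℝ → ℝ} {x : ℝ}

theorem hasDerivAt (h : IsRegularGenerator I f) (hx : x ∈ I) : HasDerivAt f (deriv f x) x :=
  ((h.timesDifferentiableOn 0 (by norm_num)).differentiableAt (h.isOpen.mem_nhds hx)).hasDerivAt

theorem hasDerivAt_deriv (h : IsRegularGenerator I f) (hx : x ∈ I) :
    HasDerivAt (deriv f) (deriv (deriv f) x) x :=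
  ((h.timesDifferentiableOn 1 (by norm_num)).differentiableAt (h.isOpen.mem_nhds hx)).hasDerivAt

theorem hasDerivAt_deriv_deriv (h : IsRegularGenerator I f) (hx : x ∈ I) :
    HasDerivAt (deriv (deriv f)) (deriv (deriv (deriv f)) x) x :=
  ((h.timesDifferentiableOn 2 (by norm_num)).differentiableAt (h.isOpen.mem_nhds hx)).hasDerivAt

theorem continuousOn (h : IsRegularGenerator I f) : ContinuousOn f I :=
  fun _ hx => (h.hasDerivAt hx).continuousAt.continuousWithinAt

/-- By the Darboux property a nonvanishing derivative has constant sign. -/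
theorem strictMonoOn_or_strictAntiOn (h : IsRegularGenerator I f) :
    StrictMonoOn f I ∨ StrictAntiOn f I := by
  have hconv : Convex ℝ I := h.ordConnected.convex
  rcases hasDerivWithinAt_forall_lt_or_forall_gt_of_forall_ne hconv
    (fun x hx => (h.hasDerivAt hx).hasDerivWithinAt) h.deriv_ne_zero with H | H
  · exact Or.inr (strictAntiOn_of_deriv_neg hconv h.continuousOn
      fun x hx => H x (interior_subset hx))
  · exact Or.inl (strictMonoOn_of_deriv_pos hconv h.continuousOn
      fun x hx => H x (interior_subset hx))

theorem injOn (h : IsRegularGenerator I f) : InjOn f I :=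
  h.strictMonoOn_or_strictAntiOn.elim StrictMonoOn.injOn StrictAntiOn.injOn

theorem convex_image (h : IsRegularGenerator I f) : Convex ℝ (f '' I) :=
  (h.ordConnected.isPreconnected.image f h.continuousOn).ordConnected.convex

theorem genLeftInverse_apply (h : IsRegularGenerator I f) (hx : x ∈ I) :
    genLeftInverse I f (f x) = x :=
  (isGenLeftInverse_genLeftInverse h.ordConnected h.strictMonoOn_or_strictAntiOn).leftInv x hx

/-- As `f'` is continuous, `f` is strictly differentiable, and so is any local left inverse. -/
theorem hasDerivAt_genLeftInverse (h : IsRegularGenerator I f) (hx : x ∈ I) :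
    HasDerivAt (genLeftInverse I f) (deriv f x)⁻¹ (f x) := by
  have hI := h.isOpen.mem_nhds hx
  have hs : HasStrictDerivAt f (deriv f x) x :=
    hasStrictDerivAt_of_hasDerivAt_of_continuousAt
      (by filter_upwards [hI] with y hy using h.hasDerivAt hy) (h.hasDerivAt_deriv hx).continuousAt
  exact (hs.to_local_left_inverse (h.deriv_ne_zero x hx)
    (by filter_upwards [hI] with y hy using h.genLeftInverse_apply hy)).hasDerivAt

end IsRegularGenerator

/-! ### Sums of functions of separate variables -/

/-- The total weight `p₁(x₁) + ⋯ + pₙ(xₙ)`. -/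
noncomputable def totalWeight {n : ℕ} (p : Fin n → ℝ → ℝ) (x : Fin n → ℝ) : ℝ :=
  ∑ ℓ, p ℓ (x ℓ)

theorem totalWeight_pos {n : ℕ} {I : Set ℝ} {p : Fin n → ℝ → ℝ} (i : Fin n)
    (hp : ∀ ℓ, ∀ x ∈ I, 0 < p ℓ x) {x : Fin n → ℝ} (hx : x ∈ cube n I) : 0 < totalWeight p x :=
  Finset.sum_pos (fun ℓ _ => hp ℓ _ (hx ℓ)) ⟨i, Finset.mem_univ i⟩

theorem update_mem_cube {n : ℕ} {I : Set ℝ} {x : Fin n → ℝ} (hx : x ∈ cube n I) (ℓ : Fin n)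
    {s : ℝ} (hs : s ∈ I) : Function.update x ℓ s ∈ cube n I := by
  intro m
  rcases eq_or_ne m ℓ with rfl | hm
  · simpa using hs
  · simpa [hm] using hx m

theorem const_mem_cube {n : ℕ} {I : Set ℝ} {t : ℝ} (ht : t ∈ I) : (fun _ => t) ∈ cube n I :=
  fun _ => ht

theorem isOpen_cube {n : ℕ} {I : Set ℝ} (hI : IsOpen I) : IsOpen (cube n I) := by
  have : cube n I = Set.pi univ fun _ => I := by ext; simp [cube]
  rw [this]
  exact isOpen_set_pi finite_univ fun _ _ => hI

theorem cubeDiag_subset_cube {n : ℕ} {I : Set ℝ} : cubeDiag n I ⊆ cube n I := by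
  rintro _ ⟨t, ht, rfl⟩
  exact const_mem_cube ht

/-- A sum of functions of the separate variables, as a function of the `ℓ`-th variable. -/
theorem sum_update {n : ℕ} (h : Fin n → ℝ → ℝ) (x : Fin n → ℝ) (ℓ : Fin n) (s : ℝ) :
    ∑ m, h m (Function.update x ℓ s m) = h ℓ s + ∑ m ∈ Finset.univ.erase ℓ, h m (x m) := by
  rw [← Finset.add_sum_erase _ _ (Finset.mem_univ ℓ), Function.update_self]
  congr 1
  refine Finset.sum_congr rfl fun m hm => ?_
  rw [Function.update_of_ne (Finset.ne_of_mem_erase hm)]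

theorem hasDerivAt_sum_update {n : ℕ} {h : Fin n → ℝ → ℝ} {x : Fin n → ℝ} {ℓ : Fin n} {d : ℝ}
    (hd : HasDerivAt (h ℓ) d (x ℓ)) :
    HasDerivAt (fun s => ∑ m, h m (Function.update x ℓ s m)) d (x ℓ) := by
  simp only [sum_update]
  exact hd.add_const _

theorem hasDerivAt_totalWeight_update {n : ℕ} {p : Fin n → ℝ → ℝ} {x : Fin n → ℝ} {ℓ : Fin n}
    {d : ℝ} (hd : HasDerivAt (p ℓ) d (x ℓ)) :
    HasDerivAt (fun s => totalWeight p (Function.update x ℓ s)) d (x ℓ) :=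
  hasDerivAt_sum_update hd

/-- A product `u v` with `u t = 0` is differentiable at `t` as soon as `u` is differentiable and
`v` is merely continuous there. -/
theorem HasDerivAt.mul_continuousAt_of_eq_zero {u v : ℝ → ℝ} {u' t : ℝ} (hu : HasDerivAt u u' t)
    (h0 : u t = 0) (hv : ContinuousAt v t) : HasDerivAt (fun s => u s * v s) (u' * v t) t := by
  rw [hasDerivAt_iff_tendsto_slope] at hu ⊢
  refine (hu.mul (hv.tendsto.mono_left nhdsWithin_le_nhds)).congr fun s => ?_
  simp only [slope_def_field, h0]
  ring

/-! ### Partial derivatives of the mean on the cube -/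

section Mean

variable {n : ℕ} {I : Set ℝ} {f : ℝ → ℝ} {p : Fin n → ℝ → ℝ}

/-- The weighted average of the values of the generator belongs to the interval `f(I)`, so that
the generalized left inverse acts on it as a true inverse. -/
theorem IsRegularGenerator.mean_spec (h : IsRegularGenerator I f) (i : Fin n)
    (hp : ∀ ℓ, ∀ x ∈ I, 0 < p ℓ x) {x : Fin n → ℝ} (hx : x ∈ cube n I) :
    bajraktarevicMean I f p x ∈ I ∧
      f (bajraktarevicMean I f p x) = (∑ ℓ, p ℓ (x ℓ) * f (x ℓ)) / totalWeight p x := by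
  have hD := totalWeight_pos i hp hx
  have hmem : (∑ ℓ, p ℓ (x ℓ) * f (x ℓ)) / totalWeight p x ∈ f '' I := by
    have := h.convex_image.sum_mem (t := Finset.univ) (w := fun ℓ => p ℓ (x ℓ) / totalWeight p x)
      (z := fun ℓ => f (x ℓ)) (fun ℓ _ => (div_pos (hp ℓ _ (hx ℓ)) hD).le)
      (by rw [← Finset.sum_div]; exact div_self hD.ne') (fun ℓ _ => mem_image_of_mem f (hx ℓ))
    convert this using 1
    rw [Finset.sum_div]
    exact Finset.sum_congr rfl fun ℓ _ => by rw [smul_eq_mul]; ring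
  obtain ⟨y, hy, hfy⟩ := hmem
  have hA : bajraktarevicMean I f p x = y := by
    change genLeftInverse I f (_ / totalWeight p x) = y
    rw [← hfy, h.genLeftInverse_apply hy]
  rw [hA]
  exact ⟨hy, hfy⟩

theorem IsRegularGenerator.mean_const (h : IsRegularGenerator I f) (i : Fin n)
    (hp : ∀ ℓ, ∀ x ∈ I, 0 < p ℓ x) {t : ℝ} (ht : t ∈ I) :
    bajraktarevicMean I f p (fun _ => t) = t := by
  obtain ⟨h1, h2⟩ := h.mean_spec i hp (const_mem_cube ht)
  refine h.injOn h1 ht ?_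
  rw [h2, div_eq_iff (totalWeight_pos i hp (const_mem_cube ht)).ne', ← Finset.sum_mul, mul_comm,
    totalWeight]

/-- The mean inherits a derivative from the weighted average of the values of the generator. -/
theorem IsRegularGenerator.hasDerivAt_mean_of_quotient (h : IsRegularGenerator I f) (i : Fin n)
    (hp : ∀ ℓ, ∀ x ∈ I, 0 < p ℓ x) {x : Fin n → ℝ} (hx : x ∈ cube n I) {ℓ : Fin n} {d : ℝ}
    (hd : HasDerivAt (fun s => (∑ m, p m (Function.update x ℓ s m) * f (Function.update x ℓ s m)) /
      totalWeight p (Function.update x ℓ s)) d (x ℓ)) :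
    HasDerivAt (fun s => bajraktarevicMean I f p (Function.update x ℓ s))
      (d / deriv f (bajraktarevicMean I f p x)) (x ℓ) := by
  obtain ⟨h1, h2⟩ := h.mean_spec i hp hx
  have hG := h.hasDerivAt_genLeftInverse h1
  have := HasDerivAt.comp_of_eq (x ℓ) hG hd (by simp [h2])
  rw [inv_mul_eq_div] at this
  exact this

/-- The value of the partial derivative `∂_ℓ A_{f,p}` at a general point of the cube. -/
noncomputable def meanD1 (I : Set ℝ) (f : ℝ → ℝ) (p : Fin n → ℝ → ℝ) (ℓ : Fin n)
    (x : Fin n → ℝ) : ℝ :=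
  (deriv (p ℓ) (x ℓ) * (f (x ℓ) - f (bajraktarevicMean I f p x)) + p ℓ (x ℓ) * deriv f (x ℓ)) /
    (deriv f (bajraktarevicMean I f p x) * totalWeight p x)

/-- The value of the partial derivative `∂_j ∂_k A_{f,p}`, `j ≠ k`, at a general point of the
cube. -/
noncomputable def meanD2 (I : Set ℝ) (f : ℝ → ℝ) (p : Fin n → ℝ → ℝ) (j k : Fin n)
    (x : Fin n → ℝ) : ℝ :=
  -(deriv (p k) (x k) * meanD1 I f p j x + deriv (p j) (x j) * meanD1 I f p k x) /
      totalWeight p x -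
    deriv (deriv f) (bajraktarevicMean I f p x) / deriv f (bajraktarevicMean I f p x) *
      (meanD1 I f p j x * meanD1 I f p k x)

/-- The derivative of `f'' / f'`. -/
noncomputable def derivLogDeriv (f : ℝ → ℝ) (t : ℝ) : ℝ :=
  (deriv (deriv (deriv f)) t * deriv f t - deriv (deriv f) t * deriv (deriv f) t) / deriv f t ^ 2

/-- The value of the partial derivative `∂_i ∂_j ∂_k A_{f,p}`, with `i`, `j`, `k` pairwise
distinct, at a general point of the cube. -/
noncomputable def meanD3 (I : Set ℝ) (f : ℝ → ℝ) (p : Fin n → ℝ → ℝ) (i j k : Fin n)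
    (x : Fin n → ℝ) : ℝ :=
  -(deriv (p k) (x k) * meanD2 I f p i j x + deriv (p j) (x j) * meanD2 I f p i k x) /
      totalWeight p x +
    (deriv (p k) (x k) * meanD1 I f p j x + deriv (p j) (x j) * meanD1 I f p k x) *
      deriv (p i) (x i) / totalWeight p x ^ 2 -
    derivLogDeriv f (bajraktarevicMean I f p x) * meanD1 I f p i x *
      (meanD1 I f p j x * meanD1 I f p k x) -
    deriv (deriv f) (bajraktarevicMean I f p x) / deriv f (bajraktarevicMean I f p x) *
      (meanD2 I f p i j x * meanD1 I f p k x + meanD1 I f p j x * meanD2 I f p i k x)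

theorem IsRegularGenerator.hasDerivAt_logDeriv (h : IsRegularGenerator I f) {t : ℝ} (ht : t ∈ I) :
    HasDerivAt (fun t => deriv (deriv f) t / deriv f t) (derivLogDeriv f t) t :=
  (h.hasDerivAt_deriv_deriv ht).fun_div (h.hasDerivAt_deriv ht) (h.deriv_ne_zero t ht)

theorem IsRegularGenerator.hasDerivAt_mean (h : IsRegularGenerator I f)
    (hp : ∀ ℓ, ∀ x ∈ I, 0 < p ℓ x) {x : Fin n → ℝ} (hx : x ∈ cube n I) {ℓ : Fin n}
    (hd : DifferentiableAt ℝ (p ℓ) (x ℓ)) :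
    HasDerivAt (fun s => bajraktarevicMean I f p (Function.update x ℓ s))
      (meanD1 I f p ℓ x) (x ℓ) := by
  have hD := totalWeight_pos ℓ hp hx
  obtain ⟨h1, h2⟩ := h.mean_spec ℓ hp hx
  have hN := hasDerivAt_sum_update (h := fun m s => p m s * f s) (x := x) (ℓ := ℓ)
    (hd.hasDerivAt.mul (h.hasDerivAt (hx ℓ)))
  have hW := hasDerivAt_totalWeight_update (x := x) hd.hasDerivAt
  have hQ := h.hasDerivAt_mean_of_quotient ℓ hp hx (hN.fun_div hW (by simpa using hD.ne'))
  convert hQ using 1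
  have h3 := h.deriv_ne_zero _ h1
  rw [eq_div_iff hD.ne'] at h2
  simp only [Function.update_eq_self, meanD1]
  rw [← h2]
  field_simp
  ring

theorem IsRegularGenerator.hasDerivAt_meanD1 (h : IsRegularGenerator I f)
    (hp : ∀ ℓ, ∀ x ∈ I, 0 < p ℓ x) {x : Fin n → ℝ} (hx : x ∈ cube n I) {j k : Fin n} (hjk : j ≠ k)
    (hd : DifferentiableAt ℝ (p j) (x j)) :
    HasDerivAt (fun s => meanD1 I f p k (Function.update x j s)) (meanD2 I f p j k x) (x j) := by
  have hD := totalWeight_pos j hp hx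
  obtain ⟨h1, -⟩ := h.mean_spec j hp hx
  have h3 := h.deriv_ne_zero _ h1
  have hA := h.hasDerivAt_mean hp hx hd
  have hW := hasDerivAt_totalWeight_update (x := x) hd.hasDerivAt
  have hfA := HasDerivAt.comp_of_eq (x j) (h.hasDerivAt h1) hA (by simp)
  have hf'A := HasDerivAt.comp_of_eq (x j) (h.hasDerivAt_deriv h1) hA (by simp)
  have hnum := ((hfA.const_sub (f (x k))).const_mul (deriv (p k) (x k))).add_const
    (p k (x k) * deriv f (x k))
  have := hnum.fun_div (hf'A.mul hW) (by simpa using ⟨h3, hD.ne'⟩)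
  simp only [meanD1, Function.update_of_ne hjk.symm]
  refine this.congr_deriv ?_
  simp only [Function.comp_def, Function.update_eq_self, meanD2, Pi.mul_apply]
  rw [show meanD1 I f p k x = (deriv (p k) (x k) * (f (x k) - f (bajraktarevicMean I f p x)) +
    p k (x k) * deriv f (x k)) /
    (deriv f (bajraktarevicMean I f p x) * totalWeight p x) from rfl]
  field_simp
  ring

theorem IsRegularGenerator.hasDerivAt_meanD2 (h : IsRegularGenerator I f)
    (hp : ∀ ℓ, ∀ x ∈ I, 0 < p ℓ x) {x : Fin n → ℝ} (hx : x ∈ cube n I) {i j k : Fin n}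
    (hij : i ≠ j) (hik : i ≠ k) (hd : DifferentiableAt ℝ (p i) (x i)) :
    HasDerivAt (fun s => meanD2 I f p j k (Function.update x i s)) (meanD3 I f p i j k x)
      (x i) := by
  have hD := totalWeight_pos i hp hx
  obtain ⟨h1, -⟩ := h.mean_spec i hp hx
  have hA := h.hasDerivAt_mean hp hx hd
  have hW := hasDerivAt_totalWeight_update (x := x) hd.hasDerivAt
  have hφ := HasDerivAt.comp_of_eq (x i) (h.hasDerivAt_logDeriv h1) hA (by simp)
  have hj := h.hasDerivAt_meanD1 hp hx hij hd
  have hk := h.hasDerivAt_meanD1 hp hx hik hd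
  have := (((hj.const_mul (deriv (p k) (x k))).fun_add
    (hk.const_mul (deriv (p j) (x j)))).fun_neg.fun_div hW (by simpa using hD.ne')).fun_sub
    (hφ.fun_mul (hj.fun_mul hk))
  simp only [meanD2, Function.update_of_ne hij.symm, Function.update_of_ne hik.symm]
  refine this.congr_deriv ?_
  simp only [Function.comp_def, Function.update_eq_self, meanD3]
  field_simp
  ring

end Mean

/-! ### Values on the diagonal -/

section Diagonal

variable {n : ℕ} {I : Set ℝ} {f : ℝ → ℝ} {p : Fin n → ℝ → ℝ}

theorem IsRegularGenerator.continuousAt_mean (h : IsRegularGenerator I f)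
    (hp : ∀ ℓ, ∀ x ∈ I, 0 < p ℓ x) {x : Fin n → ℝ} (hx : x ∈ cube n I) {ℓ : Fin n}
    (hc : ContinuousAt (p ℓ) (x ℓ)) :
    ContinuousAt (fun s => bajraktarevicMean I f p (Function.update x ℓ s)) (x ℓ) := by
  have hD := totalWeight_pos ℓ hp hx
  obtain ⟨h1, h2⟩ := h.mean_spec ℓ hp hx
  have hN : ContinuousAt (fun s => ∑ m, p m (Function.update x ℓ s m) *
      f (Function.update x ℓ s m)) (x ℓ) := by
    simp only [sum_update fun m s => p m s * f s]
    exact (hc.mul (h.hasDerivAt (hx ℓ)).continuousAt).add continuousAt_const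
  have hW : ContinuousAt (fun s => totalWeight p (Function.update x ℓ s)) (x ℓ) := by
    simp only [totalWeight, sum_update]
    exact hc.add continuousAt_const
  have hQ := hN.div₀ hW (by simpa using hD.ne')
  exact ContinuousAt.comp_of_eq (h.hasDerivAt_genLeftInverse h1).continuousAt hQ (by simp [h2, totalWeight])

/-- At a point of the diagonal the first partial derivative exists even if the weight is only
continuous: the average of the values of `f` differs from `f t` by
`p_ℓ(s) (f(s) - f(t))` over the total weight, and the factor `f(s) - f(t)` vanishes at `s = t`. -/
theorem IsRegularGenerator.hasDerivAt_mean_diag (h : IsRegularGenerator I f)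
    (hp : ∀ ℓ, ∀ x ∈ I, 0 < p ℓ x) {t : ℝ} (ht : t ∈ I) {ℓ : Fin n}
    (hc : ContinuousAt (p ℓ) t) :
    HasDerivAt (fun s => bajraktarevicMean I f p (Function.update (fun _ => t) ℓ s))
      (p ℓ t / totalWeight p fun _ => t) t := by
  have hx : (fun _ => t) ∈ cube n I := const_mem_cube ht
  have hD := totalWeight_pos ℓ hp hx
  have hW : ContinuousAt (fun s => totalWeight p (Function.update (fun _ => t) ℓ s)) t := by
    simp only [totalWeight, sum_update]
    exact hc.add continuousAt_const
  have hmul := HasDerivAt.mul_continuousAt_of_eq_zero ((h.hasDerivAt ht).sub_const (f t))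
    (sub_self _) (hc.div₀ hW (by simpa using hD.ne'))
  have hd := (hmul.const_add (f t)).congr_of_eventuallyEq
    (f₁ := fun s => (∑ m, p m (Function.update (fun _ => t) ℓ s m) *
      f (Function.update (fun _ => t) ℓ s m)) / totalWeight p (Function.update (fun _ => t) ℓ s))
    (by
      filter_upwards [h.isOpen.mem_nhds ht] with s hs
      have hDs := totalWeight_pos ℓ hp (update_mem_cube hx ℓ hs)
      have e1 := sum_update (fun m s => p m s * f s) (fun _ => t) ℓ s
      have e2 : totalWeight p (Function.update (fun _ => t) ℓ s) = _ :=
        sum_update p (fun _ => t) ℓ s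
      rw [e1, ← Finset.sum_mul]
      rw [e2] at hDs ⊢
      field_simp
      ring)
  have := h.hasDerivAt_mean_of_quotient ℓ hp hx hd
  rw [h.mean_const ℓ hp ht] at this
  refine this.congr_deriv ?_
  have h3 := h.deriv_ne_zero t ht
  simp only [Function.update_eq_self]
  field_simp

theorem IsRegularGenerator.meanD1_const (h : IsRegularGenerator I f)
    (hp : ∀ ℓ, ∀ x ∈ I, 0 < p ℓ x) {t : ℝ} (ht : t ∈ I) (ℓ : Fin n) :
    meanD1 I f p ℓ (fun _ => t) = p ℓ t / totalWeight p fun _ => t := by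
  have h3 := h.deriv_ne_zero t ht
  rw [meanD1, h.mean_const ℓ hp ht]
  field_simp
  ring

theorem IsRegularGenerator.meanD2_const (h : IsRegularGenerator I f)
    (hp : ∀ ℓ, ∀ x ∈ I, 0 < p ℓ x) {t : ℝ} (ht : t ∈ I) (j k : Fin n) :
    meanD2 I f p j k (fun _ => t) =
      -(deriv (p k) t * p j t + deriv (p j) t * p k t +
        deriv (deriv f) t / deriv f t * (p j t * p k t)) / (totalWeight p fun _ => t) ^ 2 := by
  have hD := totalWeight_pos j hp (const_mem_cube ht)
  simp only [meanD2, h.mean_const j hp ht, h.meanD1_const hp ht]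
  field_simp
  ring

theorem IsRegularGenerator.meanD3_const (h : IsRegularGenerator I f)
    (hp : ∀ ℓ, ∀ x ∈ I, 0 < p ℓ x) {t : ℝ} (ht : t ∈ I) (i j k : Fin n) :
    meanD3 I f p i j k (fun _ => t) =
      (2 * (deriv (p i) t * deriv (p j) t * p k t + deriv (p i) t * p j t * deriv (p k) t +
          p i t * deriv (p j) t * deriv (p k) t) +
        2 * (deriv (deriv f) t / deriv f t) *
          (deriv (p i) t * p j t * p k t + p i t * deriv (p j) t * p k t +
            p i t * p j t * deriv (p k) t) +
        (2 * (deriv (deriv f) t / deriv f t) ^ 2 - derivLogDeriv f t) * (p i t * p j t * p k t)) /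
        (totalWeight p fun _ => t) ^ 3 := by
  have hD := totalWeight_pos j hp (const_mem_cube ht)
  simp only [meanD3, h.mean_const j hp ht, h.meanD1_const hp ht, h.meanD2_const hp ht]
  generalize deriv (deriv f) t / deriv f t = φ
  field_simp
  ring

end Diagonal

/-! ### Iterated partial derivatives -/

section IteratedPartialDerivatives

variable {n : ℕ} {I : Set ℝ} {f : ℝ → ℝ} {p : Fin n → ℝ → ℝ}

/-- One more partial derivative of an iterated partial derivative whose values `G` are known on the
whole cube: since `I` is open, the inner derivative exists near `x` along the axis. -/
theorem iterPartialDeriv_cons_of_hasDerivAt (hI : IsOpen I) {L : List (Fin n)}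
    {F G : (Fin n → ℝ) → ℝ}
    (hG : ∀ y ∈ cube n I, IterPartialDerivExists L F y ∧ iterPartialDeriv L F y = G y)
    {x : Fin n → ℝ} (hx : x ∈ cube n I) {i : Fin n} {d : ℝ}
    (hd : HasDerivAt (fun s => G (Function.update x i s)) d (x i)) :
    IterPartialDerivExists (i :: L) F x ∧ iterPartialDeriv (i :: L) F x = d := by
  have hev : ∀ᶠ s in 𝓝 (x i), Function.update x i s ∈ cube n I := by
    filter_upwards [hI.mem_nhds (hx i)] with s hs using update_mem_cube hx i hs
  have hd' : HasDerivAt (fun s => iterPartialDeriv L F (Function.update x i s)) d (x i) :=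
    hd.congr_of_eventuallyEq (hev.mono fun s hs => (hG _ hs).2)
  exact ⟨⟨hev.mono fun s hs => (hG _ hs).1, hd'.differentiableAt⟩, hd'.deriv⟩

theorem iterPartialDeriv_eqOn {F G : (Fin n → ℝ) → ℝ} {U : Set (Fin n → ℝ)} (hU : IsOpen U)
    (hFG : EqOn F G U) (L : List (Fin n)) :
    EqOn (iterPartialDeriv L F) (iterPartialDeriv L G) U := by
  induction L with
  | nil => exact hFG
  | cons i L ih =>
    intro x hx
    refine EventuallyEq.deriv_eq ?_
    have hc : ContinuousAt (fun s => Function.update x i s) (x i) :=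
      (continuous_const.update i continuous_id).continuousAt
    have hev : ∀ᶠ s in 𝓝 (x i), Function.update x i s ∈ U :=
      hc.eventually (by simpa using hU.mem_nhds hx)
    exact hev.mono fun s hs => ih hs

theorem IsRegularGenerator.iterPartialDeriv_mean_one (h : IsRegularGenerator I f)
    (hp : ∀ ℓ, ∀ x ∈ I, 0 < p ℓ x) {k : Fin n} (hk : DifferentiableOn ℝ (p k) I)
    {x : Fin n → ℝ} (hx : x ∈ cube n I) :
    IterPartialDerivExists [k] (bajraktarevicMean I f p) x ∧
      iterPartialDeriv [k] (bajraktarevicMean I f p) x = meanD1 I f p k x :=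
  iterPartialDeriv_cons_of_hasDerivAt (L := []) h.isOpen (fun _ _ => ⟨trivial, rfl⟩) hx
    (h.hasDerivAt_mean hp hx (hk.differentiableAt (h.isOpen.mem_nhds (hx k))))

theorem IsRegularGenerator.iterPartialDeriv_mean_two (h : IsRegularGenerator I f)
    (hp : ∀ ℓ, ∀ x ∈ I, 0 < p ℓ x) {j k : Fin n} (hjk : j ≠ k)
    (hj : DifferentiableOn ℝ (p j) I) (hk : DifferentiableOn ℝ (p k) I)
    {x : Fin n → ℝ} (hx : x ∈ cube n I) :
    IterPartialDerivExists [j, k] (bajraktarevicMean I f p) x ∧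
      iterPartialDeriv [j, k] (bajraktarevicMean I f p) x = meanD2 I f p j k x :=
  iterPartialDeriv_cons_of_hasDerivAt h.isOpen
    (fun _ hy => h.iterPartialDeriv_mean_one hp hk hy) hx
    (h.hasDerivAt_meanD1 hp hx hjk (hj.differentiableAt (h.isOpen.mem_nhds (hx j))))

theorem IsRegularGenerator.iterPartialDeriv_mean_three (h : IsRegularGenerator I f)
    (hp : ∀ ℓ, ∀ x ∈ I, 0 < p ℓ x) {i j k : Fin n} (hij : i ≠ j) (hjk : j ≠ k) (hik : i ≠ k)
    (hi : DifferentiableOn ℝ (p i) I) (hj : DifferentiableOn ℝ (p j) I)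
    (hk : DifferentiableOn ℝ (p k) I) {x : Fin n → ℝ} (hx : x ∈ cube n I) :
    IterPartialDerivExists [i, j, k] (bajraktarevicMean I f p) x ∧
      iterPartialDeriv [i, j, k] (bajraktarevicMean I f p) x = meanD3 I f p i j k x :=
  iterPartialDeriv_cons_of_hasDerivAt h.isOpen
    (fun _ hy => h.iterPartialDeriv_mean_two hp hjk hj hk hy) hx
    (h.hasDerivAt_meanD2 hp hx hij hik (hi.differentiableAt (h.isOpen.mem_nhds (hx i))))

theorem IsRegularGenerator.iterPartialDeriv_mean_diag (h : IsRegularGenerator I f)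
    (hp : ∀ ℓ, ∀ x ∈ I, 0 < p ℓ x) {ℓ : Fin n} (hc : ContinuousOn (p ℓ) I) {t : ℝ} (ht : t ∈ I) :
    IterPartialDerivExists [ℓ] (bajraktarevicMean I f p) (fun _ => t) ∧
      iterPartialDeriv [ℓ] (bajraktarevicMean I f p) (fun _ => t) =
        p ℓ t / totalWeight p fun _ => t :=
  iterPartialDeriv_cons_of_hasDerivAt (L := []) h.isOpen (fun _ _ => ⟨trivial, rfl⟩) (const_mem_cube ht)
    (h.hasDerivAt_mean_diag hp ht (hc.continuousAt (h.isOpen.mem_nhds ht)))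

end IteratedPartialDerivatives

/-! ### Regularity of the second weight -/

section Regularity

variable {n : ℕ} {I : Set ℝ} {g : ℝ → ℝ} {q : Fin n → ℝ → ℝ}

/-- If `F` agrees with `A_{g,q}` near the diagonal, then `q_ℓ` is locally expressed through `g`
and the restriction of `F` to a line: keep all the variables but the `ℓ`-th at a value `t` close
to, but different from, `x₀`, and solve the equation defining the mean for `q_ℓ`. -/
theorem IsRegularGenerator.exists_weight_eventuallyEq (h : IsRegularGenerator I g)
    (hq : ∀ ℓ, ∀ x ∈ I, 0 < q ℓ x) {U : Set (Fin n → ℝ)} (hUI : U ⊆ cube n I) (hU : IsOpen U)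
    (hdiag : cubeDiag n I ⊆ U) {F : (Fin n → ℝ) → ℝ} (hF : EqOn F (bajraktarevicMean I g q) U)
    {ℓ m : Fin n} (hm : m ≠ ℓ) {x₀ : ℝ} (hx₀ : x₀ ∈ I) :
    ∃ t ∈ I, ∃ c : ℝ, F (Function.update (fun _ => t) ℓ x₀) ∈ I ∧
      g (F (Function.update (fun _ => t) ℓ x₀)) - g x₀ ≠ 0 ∧
      q ℓ =ᶠ[𝓝 x₀] fun s => c * (g t - g (F (Function.update (fun _ => t) ℓ s))) /
        (g (F (Function.update (fun _ => t) ℓ s)) - g s) := by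
  have hcont : Continuous fun t : ℝ => Function.update (fun _ : Fin n => t) ℓ x₀ :=
    (continuous_pi fun _ => continuous_id).update ℓ continuous_const
  have hev : ∀ᶠ t in 𝓝 x₀, Function.update (fun _ : Fin n => t) ℓ x₀ ∈ U ∧ t ∈ I := by
    refine (hcont.continuousAt.eventually (hU.mem_nhds ?_)).and (h.isOpen.mem_nhds hx₀)
    exact hdiag ⟨x₀, hx₀, Function.update_eq_self ℓ fun _ => x₀⟩
  obtain ⟨t, ⟨htU, ht⟩, htx : t ≠ x₀⟩ :=
    ((hev.filter_mono nhdsWithin_le_nhds).and (self_mem_nhdsWithin (a := x₀) (s := {x₀}ᶜ))).exists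
  have hcont' : Continuous fun s : ℝ => Function.update (fun _ : Fin n => t) ℓ s :=
    continuous_const.update ℓ continuous_id
  have hevU : ∀ᶠ s in 𝓝 x₀, Function.update (fun _ : Fin n => t) ℓ s ∈ U :=
    hcont'.continuousAt.eventually (hU.mem_nhds htU)
  set c := ∑ m ∈ Finset.univ.erase ℓ, q m t with hc
  have hcpos : 0 < c :=
    Finset.sum_pos (fun m _ => hq m t ht) ⟨m, Finset.mem_erase.2 ⟨hm, Finset.mem_univ m⟩⟩
  have heq : ∀ s, Function.update (fun _ : Fin n => t) ℓ s ∈ U →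
      q ℓ s * (g (F (Function.update (fun _ => t) ℓ s)) - g s) =
        c * (g t - g (F (Function.update (fun _ => t) ℓ s))) := by
    intro s hs
    obtain ⟨-, h2⟩ := h.mean_spec ℓ hq (hUI hs)
    have e1 := sum_update (fun m s => q m s * g s) (fun _ => t) ℓ s
    have e2 : totalWeight q (Function.update (fun _ => t) ℓ s) = _ :=
      sum_update q (fun _ => t) ℓ s
    rw [← hF hs, eq_div_iff (totalWeight_pos ℓ hq (hUI hs)).ne', e1, e2, ← Finset.sum_mul,
      ← hc] at h2
    linear_combination h2
  have hmem : F (Function.update (fun _ => t) ℓ x₀) ∈ I := by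
    rw [hF htU]
    exact (h.mean_spec ℓ hq (hUI htU)).1
  have hne : ∀ s ∈ I, s ≠ t → Function.update (fun _ : Fin n => t) ℓ s ∈ U →
      g (F (Function.update (fun _ => t) ℓ s)) - g s ≠ 0 := by
    intro s hsI hst hs h0
    have h1 := heq s hs
    rw [h0, mul_zero, sub_eq_zero.1 h0, eq_comm, mul_eq_zero, or_iff_right hcpos.ne',
      sub_eq_zero] at h1
    exact hst (h.injOn ht hsI h1).symm
  refine ⟨t, ht, c, hmem, hne x₀ hx₀ htx.symm htU, ?_⟩
  filter_upwards [hevU, h.isOpen.mem_nhds hx₀, isOpen_ne.mem_nhds htx.symm] with s hs hsI hst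
  rw [eq_div_iff (hne s hsI hst hs), heq s hs]

end Regularity

/-! ### Equality of two means -/

section Equality

variable {n : ℕ} {I : Set ℝ} {f g : ℝ → ℝ} {p q : Fin n → ℝ → ℝ}

theorem IsRegularGenerator.continuousOn_weight (hf : IsRegularGenerator I f)
    (hg : IsRegularGenerator I g) (hp : ∀ ℓ, ∀ x ∈ I, 0 < p ℓ x) (hq : ∀ ℓ, ∀ x ∈ I, 0 < q ℓ x)
    {U : Set (Fin n → ℝ)} (hUI : U ⊆ cube n I) (hU : IsOpen U) (hdiag : cubeDiag n I ⊆ U)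
    (hfg : EqOn (bajraktarevicMean I f p) (bajraktarevicMean I g q) U)
    {ℓ m : Fin n} (hm : m ≠ ℓ) (hc : ContinuousOn (p ℓ) I) : ContinuousOn (q ℓ) I := by
  intro x₀ hx₀
  obtain ⟨t, ht, c, hmem, hne, heq⟩ :=
    hg.exists_weight_eventuallyEq hq hUI hU hdiag hfg hm hx₀
  have hA : ContinuousAt
      (fun s => bajraktarevicMean I f p (Function.update (fun _ => t) ℓ s)) x₀ := by
    have := hf.continuousAt_mean hp (update_mem_cube (const_mem_cube ht) ℓ hx₀) (ℓ := ℓ)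
      (by simpa using hc.continuousAt (hf.isOpen.mem_nhds hx₀))
    simpa using this
  have hgA := ContinuousAt.comp (f := fun s =>
    bajraktarevicMean I f p (Function.update (fun _ => t) ℓ s)) (hg.hasDerivAt hmem).continuousAt hA
  exact ((((continuousAt_const.sub hgA).const_mul c).div₀
    (hgA.sub (hg.hasDerivAt hx₀).continuousAt) hne).congr heq.symm).continuousWithinAt

theorem IsRegularGenerator.differentiableOn_weight (hf : IsRegularGenerator I f)
    (hg : IsRegularGenerator I g) (hp : ∀ ℓ, ∀ x ∈ I, 0 < p ℓ x) (hq : ∀ ℓ, ∀ x ∈ I, 0 < q ℓ x)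
    {U : Set (Fin n → ℝ)} (hUI : U ⊆ cube n I) (hU : IsOpen U) (hdiag : cubeDiag n I ⊆ U)
    (hfg : EqOn (bajraktarevicMean I f p) (bajraktarevicMean I g q) U)
    {ℓ m : Fin n} (hm : m ≠ ℓ) (hd : DifferentiableOn ℝ (p ℓ) I) :
    DifferentiableOn ℝ (q ℓ) I := by
  intro x₀ hx₀
  obtain ⟨t, ht, c, hmem, hne, heq⟩ :=
    hg.exists_weight_eventuallyEq hq hUI hU hdiag hfg hm hx₀
  have hA : DifferentiableAt ℝ
      (fun s => bajraktarevicMean I f p (Function.update (fun _ => t) ℓ s)) x₀ := by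
    have := (hf.hasDerivAt_mean hp (update_mem_cube (const_mem_cube ht) ℓ hx₀) (ℓ := ℓ)
      (by simpa using hd.differentiableAt (hf.isOpen.mem_nhds hx₀))).differentiableAt
    simpa using this
  have hgA := DifferentiableAt.fun_comp' x₀ (hg.hasDerivAt hmem).differentiableAt hA
  exact ((((hgA.const_sub (g t)).const_mul c).fun_div
    (hgA.sub (hg.hasDerivAt hx₀).differentiableAt) hne).congr_of_eventuallyEq
      heq).differentiableWithinAt

/-- With `N` and `P` the numerator and the denominator for `(f, p)`, those for `(g, q)` are
`a N + b P` and `c N + d P`. -/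
theorem IsRegularGenerator.mean_eqOn_of_fractional (hf : IsRegularGenerator I f)
    (hg : IsRegularGenerator I g) (i : Fin n) (hp : ∀ ℓ, ∀ x ∈ I, 0 < p ℓ x)
    (hq : ∀ ℓ, ∀ x ∈ I, 0 < q ℓ x) {a b c d : ℝ}
    (hgf : ∀ x ∈ I, g x = (a * f x + b) / (c * f x + d))
    (hqp : ∀ ℓ, ∀ x ∈ I, q ℓ x = (c * f x + d) * p ℓ x) :
    EqOn (bajraktarevicMean I f p) (bajraktarevicMean I g q) (cube n I) := by
  intro x hx
  have hpos : ∀ y ∈ I, 0 < c * f y + d := fun y hy =>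
    pos_of_mul_pos_left (hqp i y hy ▸ hq i y hy) (hp i y hy).le
  obtain ⟨hf1, hf2⟩ := hf.mean_spec i hp hx
  obtain ⟨hg1, hg2⟩ := hg.mean_spec i hq hx
  have hP := totalWeight_pos i hp hx
  have hQ := totalWeight_pos i hq hx
  refine hg.injOn hf1 hg1 ?_
  have hQe : totalWeight q x = c * (∑ ℓ, p ℓ (x ℓ) * f (x ℓ)) + d * totalWeight p x := by
    simp only [totalWeight, Finset.mul_sum, ← Finset.sum_add_distrib]
    refine Finset.sum_congr rfl fun ℓ _ => ?_
    rw [hqp ℓ _ (hx ℓ)]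
    ring
  have hNe : ∑ ℓ, q ℓ (x ℓ) * g (x ℓ) =
      a * (∑ ℓ, p ℓ (x ℓ) * f (x ℓ)) + b * totalWeight p x := by
    simp only [totalWeight, Finset.mul_sum, ← Finset.sum_add_distrib]
    refine Finset.sum_congr rfl fun ℓ _ => ?_
    have := (hpos _ (hx ℓ)).ne'
    rw [hqp ℓ _ (hx ℓ), hgf _ (hx ℓ)]
    field_simp
  have h3 := (hpos _ hf1).ne'
  rw [hg2, hgf _ hf1, hNe, div_eq_div_iff h3 hQ.ne', hQe]
  rw [eq_div_iff hP.ne'] at hf2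
  rw [← hf2]
  ring

/-- Since the first partial derivatives of a mean on the diagonal add up to `1`, all of them
agree as soon as all but the last one do. -/
theorem eq_of_sum_eq_one_of_eq_of_lt {P Q : Fin n → ℝ} (hP : ∑ ℓ, P ℓ = 1) (hQ : ∑ ℓ, Q ℓ = 1)
    (h : ∀ ℓ : Fin n, (ℓ : ℕ) + 1 < n → P ℓ = Q ℓ) (ℓ : Fin n) : P ℓ = Q ℓ := by
  by_cases hℓ : (ℓ : ℕ) + 1 < n
  · exact h ℓ hℓ
  · have hrest : ∑ m ∈ Finset.univ.erase ℓ, P m = ∑ m ∈ Finset.univ.erase ℓ, Q m := by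
      refine Finset.sum_congr rfl fun m hm => h m ?_
      have hne := Fin.val_ne_of_ne (Finset.ne_of_mem_erase hm)
      have := m.isLt
      have := ℓ.isLt
      omega
    rw [← Finset.add_sum_erase _ _ (Finset.mem_univ ℓ)] at hP hQ
    linarith

theorem exists_eq_const_of_hasDerivAt_zero (hI : IsOpen I) (hI' : I.OrdConnected) {u : ℝ → ℝ}
    (hu : ∀ x ∈ I, HasDerivAt u 0 x) : ∃ c, ∀ x ∈ I, u x = c :=
  hI.exists_is_const_of_deriv_eq_zero hI'.isPreconnected
    (fun x hx => (hu x hx).differentiableAt.differentiableWithinAt) fun x hx => (hu x hx).deriv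

/-- The ratio `r` of the weights solves `r'' = (f'' / f') r'`, hence it is an affine function
of `f`; and then so is `g r`, because `((g r)' / f')' = 0`. -/
theorem IsRegularGenerator.exists_fractional (hf : IsRegularGenerator I f)
    (hg : IsRegularGenerator I g) (hne : I.Nonempty) {r r₁ : ℝ → ℝ} (hr0 : ∀ x ∈ I, 0 < r x)
    (hr : ∀ x ∈ I, HasDerivAt r (r₁ x) x)
    (hr₁ : ∀ x ∈ I, HasDerivAt r₁ (deriv (deriv f) x / deriv f x * r₁ x) x)
    (hlog : ∀ x ∈ I, deriv (deriv f) x / deriv f x * r x =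
      deriv (deriv g) x / deriv g x * r x + 2 * r₁ x) :
    ∃ a b c d : ℝ, a * d ≠ b * c ∧ (∀ x ∈ I, g x = (a * f x + b) / (c * f x + d)) ∧
      ∀ x ∈ I, r x = c * f x + d := by
  obtain ⟨c, hc⟩ := exists_eq_const_of_hasDerivAt_zero (u := fun x => r₁ x / deriv f x)
    hf.isOpen hf.ordConnected fun x hx =>
      ((hr₁ x hx).fun_div (hf.hasDerivAt_deriv hx) (hf.deriv_ne_zero x hx)).congr_deriv (by
        have := hf.deriv_ne_zero x hx
        field_simp
        ring)
  have hc' : ∀ x ∈ I, r₁ x = c * deriv f x := fun x hx =>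
    (div_eq_iff (hf.deriv_ne_zero x hx)).1 (hc x hx)
  obtain ⟨d, hd⟩ := exists_eq_const_of_hasDerivAt_zero (u := fun x => r x - c * f x)
    hf.isOpen hf.ordConnected fun x hx =>
      ((hr x hx).fun_sub ((hf.hasDerivAt hx).const_mul c)).congr_deriv (by rw [hc' x hx, sub_self])
  have hd' : ∀ x ∈ I, r x = c * f x + d := fun x hx => by linarith [hd x hx]
  obtain ⟨a, ha⟩ := exists_eq_const_of_hasDerivAt_zero
    (u := fun x => deriv g x * r x / deriv f x + c * g x) hf.isOpen hf.ordConnected fun x hx =>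
      ((((hg.hasDerivAt_deriv hx).fun_mul (hr x hx)).fun_div (hf.hasDerivAt_deriv hx)
        (hf.deriv_ne_zero x hx)).fun_add ((hg.hasDerivAt hx).const_mul c)).congr_deriv (by
        have h1 := hf.deriv_ne_zero x hx
        have h2 := hg.deriv_ne_zero x hx
        have h3 := hlog x hx
        rw [hc' x hx] at h3 ⊢
        field_simp at h3 ⊢
        linear_combination -h3)
  have ha' : ∀ x ∈ I, deriv g x * r x + c * g x * deriv f x = a * deriv f x := fun x hx => by
    have h1 := hf.deriv_ne_zero x hx
    rw [← ha x hx]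
    field_simp
  obtain ⟨b, hb⟩ := exists_eq_const_of_hasDerivAt_zero (u := fun x => g x * r x - a * f x)
    hf.isOpen hf.ordConnected fun x hx =>
      (((hg.hasDerivAt hx).fun_mul (hr x hx)).fun_sub
        ((hf.hasDerivAt hx).const_mul a)).congr_deriv (by
          rw [hc' x hx]
          linear_combination ha' x hx)
  refine ⟨a, b, c, d, ?_, ?_, hd'⟩
  · obtain ⟨x, hx⟩ := hne
    intro h0
    -- The identity `g' r² = (a d - b c) f'` would make `g'` vanish.
    have h1 : deriv g x * r x ^ 2 = 0 := by
      linear_combination r x * ha' x hx - c * deriv f x * hb x hx + a * deriv f x * hd x hx +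
        deriv f x * h0
    exact mul_ne_zero (hg.deriv_ne_zero x hx) (pow_ne_zero 2 (hr0 x hx).ne') h1
  · intro x hx
    rw [← hd' x hx, eq_div_iff (hr0 x hx).ne']
    linarith [hb x hx]

/-- Equality of the partial derivatives on the diagonal forces `g` to be a fractional linear
function of `f` with the matching weights. -/
theorem IsRegularGenerator.exists_fractional_of_meanD_eq (hf : IsRegularGenerator I f)
    (hg : IsRegularGenerator I g) (hne : I.Nonempty) (hp : ∀ ℓ, ∀ x ∈ I, 0 < p ℓ x)
    (hq : ∀ ℓ, ∀ x ∈ I, 0 < q ℓ x) {i j k : Fin n}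
    (hpi : DifferentiableOn ℝ (p i) I) (hpj : DifferentiableOn ℝ (p j) I)
    (hpk : DifferentiableOn ℝ (p k) I) (hqi : DifferentiableOn ℝ (q i) I)
    (h1 : ∀ t ∈ I, ∀ ℓ, p ℓ t / totalWeight p (fun _ => t) = q ℓ t / totalWeight q fun _ => t)
    (h2 : ∀ t ∈ I, meanD2 I f p i j (fun _ => t) = meanD2 I g q i j fun _ => t)
    (h3 : ∀ t ∈ I, meanD3 I f p i j k (fun _ => t) = meanD3 I g q i j k fun _ => t) :
    ∃ a b c d : ℝ, a * d ≠ b * c ∧ (∀ x ∈ I, g x = (a * f x + b) / (c * f x + d)) ∧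
      ∀ ℓ, ∀ x ∈ I, q ℓ x = (c * f x + d) * p ℓ x := by
  set r : ℝ → ℝ := fun t => q i t / p i t with hrdef
  have hr0 : ∀ t ∈ I, 0 < r t := fun t ht => div_pos (hq i t ht) (hp i t ht)
  have hrd : ∀ t ∈ I, HasDerivAt r (deriv r t) t := fun t ht =>
    (((hqi.differentiableAt (hf.isOpen.mem_nhds ht)).fun_div
      (hpi.differentiableAt (hf.isOpen.mem_nhds ht)) (hp i t ht).ne')).hasDerivAt
  have hP : ∀ t ∈ I, 0 < totalWeight p fun _ => t := fun t ht =>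
    totalWeight_pos i hp (const_mem_cube ht)
  have hQ : ∀ t ∈ I, 0 < totalWeight q fun _ => t := fun t ht =>
    totalWeight_pos i hq (const_mem_cube ht)
  have hqr : ∀ ℓ, ∀ t ∈ I, q ℓ t = r t * p ℓ t := by
    intro ℓ t ht
    have e1 := h1 t ht ℓ
    have e2 := h1 t ht i
    have := hP t ht
    have := hQ t ht
    have := hp i t ht
    rw [hrdef]
    field_simp at e1 e2 ⊢
    refine mul_left_cancel₀ (hP t ht).ne' ?_
    linear_combination p ℓ t * e2 - p i t * e1
  have hQP : ∀ t ∈ I, totalWeight q (fun _ => t) = r t * totalWeight p fun _ => t := by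
    intro t ht
    simp only [totalWeight, Finset.mul_sum]
    exact Finset.sum_congr rfl fun ℓ _ => hqr ℓ t ht
  have hdq : ∀ ℓ, DifferentiableOn ℝ (p ℓ) I → ∀ t ∈ I,
      deriv (q ℓ) t = deriv r t * p ℓ t + r t * deriv (p ℓ) t := by
    intro ℓ hℓ t ht
    have hev : q ℓ =ᶠ[𝓝 t] fun t => r t * p ℓ t := by
      filter_upwards [hf.isOpen.mem_nhds ht] with s hs using hqr ℓ s hs
    rw [hev.deriv_eq]
    exact ((hrd t ht).fun_mul
      (hℓ.differentiableAt (hf.isOpen.mem_nhds ht)).hasDerivAt).deriv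
  -- The second partial derivatives give `φ r = ψ r + 2 r'`.
  have hlog : ∀ t ∈ I, deriv (deriv f) t / deriv f t * r t =
      deriv (deriv g) t / deriv g t * r t + 2 * deriv r t := by
    intro t ht
    have e := h2 t ht
    rw [hf.meanD2_const hp ht, hg.meanD2_const hq ht, hQP t ht, hdq i hpi t ht, hdq j hpj t ht,
      hqr i t ht, hqr j t ht] at e
    generalize deriv (deriv f) t / deriv f t = φ at e ⊢
    generalize deriv (deriv g) t / deriv g t = ψ at e ⊢
    have hPt := hP t ht
    have hrt := hr0 t ht
    rw [div_eq_div_iff (by positivity) (by positivity)] at e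
    have hi := hp i t ht
    have hj := hp j t ht
    refine mul_left_cancel₀ (show r t * p i t * p j t * (totalWeight p fun _ => t) ^ 2 ≠ 0 by
      positivity) ?_
    linear_combination -e
  have hrd' : ∀ t ∈ I, deriv r t =
      r t * (deriv (deriv f) t / deriv f t - deriv (deriv g) t / deriv g t) / 2 := fun t ht => by
    linear_combination -hlog t ht / 2
  -- Here `r' = r (φ - ψ) / 2` is differentiable, and the third partial derivatives identify its
  -- derivative as `φ r'`.
  have hr₁ : ∀ t ∈ I, HasDerivAt (deriv r) (deriv (deriv f) t / deriv f t * deriv r t) t := by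
    intro t ht
    have hd := (((hrd t ht).fun_mul
      ((hf.hasDerivAt_logDeriv ht).fun_sub (hg.hasDerivAt_logDeriv ht))).div_const 2)
    refine (hd.congr_of_eventuallyEq (f₁ := deriv r) ?_).congr_deriv ?_
    · filter_upwards [hf.isOpen.mem_nhds ht] with s hs using hrd' s hs
    have e := h3 t ht
    rw [hf.meanD3_const hp ht, hg.meanD3_const hq ht, hQP t ht, hdq i hpi t ht, hdq j hpj t ht,
      hdq k hpk t ht, hqr i t ht, hqr j t ht, hqr k t ht] at e
    rw [hrd' t ht] at e ⊢
    generalize deriv (deriv f) t / deriv f t = φ at e ⊢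
    generalize deriv (deriv g) t / deriv g t = ψ at e ⊢
    have hPt := hP t ht
    have hrt := hr0 t ht
    rw [div_eq_div_iff (by positivity) (by positivity)] at e
    have hi := hp i t ht
    have hj := hp j t ht
    have hk := hp k t ht
    refine mul_left_cancel₀ (show r t ^ 2 * p i t * p j t * p k t *
      (totalWeight p fun _ => t) ^ 3 ≠ 0 by positivity) ?_
    linear_combination -e / 2
  obtain ⟨a, b, c, d, hne, hgf, hrf⟩ := hf.exists_fractional hg hne hr0 hrd hr₁ hlog
  exact ⟨a, b, c, d, hne, hgf, fun ℓ t ht => by rw [← hrf t ht, hqr ℓ t ht]⟩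

end Equality

theorem mainTheorem1 (I : Set ℝ) (hIne : I.Nonempty) (hIopen : IsOpen I) (hIint : I.OrdConnected)
    (n : ℕ) (hn : 3 ≤ n) (f g : ℝ → ℝ)
    (hf : TimesDifferentiableOn 3 f I) (hf' : ∀ x ∈ I, deriv f x ≠ 0)
    (hg : TimesDifferentiableOn 3 g I) (hg' : ∀ x ∈ I, deriv g x ≠ 0)
    (p q : Fin n → ℝ → ℝ)
    (hp : ∀ ℓ, ∀ x ∈ I, 0 < p ℓ x) (hq : ∀ ℓ, ∀ x ∈ I, 0 < q ℓ x)
    (hpcont : ∀ ℓ, ContinuousOn (p ℓ) I)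
    (i j k : Fin n) (hij : i ≠ j) (hjk : j ≠ k) (hki : k ≠ i)
    (hpi : DifferentiableOn ℝ (p i) I) (hpj : DifferentiableOn ℝ (p j) I)
    (hpk : DifferentiableOn ℝ (p k) I) :
    List.TFAE [
      EqOn (bajraktarevicMean I f p) (bajraktarevicMean I g q) (cube n I),
      ∃ U : Set (Fin n → ℝ), U ⊆ cube n I ∧ IsOpen U ∧ cubeDiag n I ⊆ U ∧
        EqOn (bajraktarevicMean I f p) (bajraktarevicMean I g q) U,
      (∀ ℓ, ContinuousOn (q ℓ) I) ∧
        DifferentiableOn ℝ (q i) I ∧ DifferentiableOn ℝ (q j) I ∧ DifferentiableOn ℝ (q k) I ∧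
        (∀ ℓ : Fin n, (ℓ : ℕ) + 1 < n →
          IterPartialDerivEqOn [ℓ] (bajraktarevicMean I f p) (bajraktarevicMean I g q)
            (cubeDiag n I)) ∧
        IterPartialDerivEqOn [i, j] (bajraktarevicMean I f p) (bajraktarevicMean I g q)
          (cubeDiag n I) ∧
        IterPartialDerivEqOn [i, j, k] (bajraktarevicMean I f p) (bajraktarevicMean I g q)
          (cubeDiag n I),
      ∃ a b c d : ℝ, a * d ≠ b * c ∧
        (∀ x ∈ I, g x = (a * f x + b) / (c * f x + d)) ∧
        ∀ ℓ, ∀ x ∈ I, q ℓ x = (c * f x + d) * p ℓ x] := by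
  have hF : IsRegularGenerator I f := ⟨hIopen, hIint, hf, hf'⟩
  have hG : IsRegularGenerator I g := ⟨hIopen, hIint, hg, hg'⟩
  tfae_have 1 → 2 := fun h => ⟨cube n I, subset_rfl, isOpen_cube hIopen, cubeDiag_subset_cube, h⟩
  tfae_have 2 → 3 := by
    rintro ⟨U, hUI, hU, hdiag, hfg⟩
    have hqcont : ∀ ℓ, ContinuousOn (q ℓ) I := by
      intro ℓ
      obtain ⟨m, hm⟩ : ∃ m, m ≠ ℓ := by
        rcases eq_or_ne i ℓ with rfl | h
        exacts [⟨j, hij.symm⟩, ⟨i, h⟩]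
      exact hF.continuousOn_weight hG hp hq hUI hU hdiag hfg hm (hpcont ℓ)
    have hqi := hF.differentiableOn_weight hG hp hq hUI hU hdiag hfg hij.symm hpi
    have hqj := hF.differentiableOn_weight hG hp hq hUI hU hdiag hfg hij hpj
    have hqk := hF.differentiableOn_weight hG hp hq hUI hU hdiag hfg hki.symm hpk
    refine ⟨hqcont, hqi, hqj, hqk, ?_, ?_, ?_⟩
    · rintro ℓ - _ ⟨t, ht, rfl⟩
      exact ⟨(hF.iterPartialDeriv_mean_diag hp (hpcont ℓ) ht).1,
        (hG.iterPartialDeriv_mean_diag hq (hqcont ℓ) ht).1,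
        iterPartialDeriv_eqOn hU hfg _ (hdiag ⟨t, ht, rfl⟩)⟩
    · intro x hx
      exact ⟨(hF.iterPartialDeriv_mean_two hp hij hpi hpj (hUI (hdiag hx))).1,
        (hG.iterPartialDeriv_mean_two hq hij hqi hqj (hUI (hdiag hx))).1,
        iterPartialDeriv_eqOn hU hfg _ (hdiag hx)⟩
    · intro x hx
      exact ⟨(hF.iterPartialDeriv_mean_three hp hij hjk hki.symm hpi hpj hpk
          (hUI (hdiag hx))).1,
        (hG.iterPartialDeriv_mean_three hq hij hjk hki.symm hqi hqj hqk (hUI (hdiag hx))).1,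
        iterPartialDeriv_eqOn hU hfg _ (hdiag hx)⟩
  tfae_have 3 → 4 := by
    rintro ⟨hqcont, hqi, hqj, hqk, h1, h2, h3⟩
    refine hF.exists_fractional_of_meanD_eq hG hIne hp hq hpi hpj hpk hqi ?_ ?_ ?_ (j := j) (k := k)
    · intro t ht
      refine eq_of_sum_eq_one_of_eq_of_lt ?_ ?_ fun ℓ hℓ => ?_
      · rw [← Finset.sum_div]
        exact div_self (totalWeight_pos i hp (const_mem_cube ht)).ne'
      · rw [← Finset.sum_div]
        exact div_self (totalWeight_pos i hq (const_mem_cube ht)).ne'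
      · rw [← (hF.iterPartialDeriv_mean_diag hp (hpcont ℓ) ht).2,
          ← (hG.iterPartialDeriv_mean_diag hq (hqcont ℓ) ht).2]
        exact (h1 ℓ hℓ _ ⟨t, ht, rfl⟩).2.2
    · intro t ht
      rw [← (hF.iterPartialDeriv_mean_two hp hij hpi hpj (const_mem_cube ht)).2,
        ← (hG.iterPartialDeriv_mean_two hq hij hqi hqj (const_mem_cube ht)).2]
      exact (h2 _ ⟨t, ht, rfl⟩).2.2
    · intro t ht
      rw [← (hF.iterPartialDeriv_mean_three hp hij hjk hki.symm hpi hpj hpk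
          (const_mem_cube ht)).2,
        ← (hG.iterPartialDeriv_mean_three hq hij hjk hki.symm hqi hqj hqk (const_mem_cube ht)).2]
      exact (h3 _ ⟨t, ht, rfl⟩).2.2
  tfae_have 4 → 1 := by
    rintro ⟨a, b, c, d, -, hgf, hqp⟩
    exact hF.mean_eqOn_of_fractional hG i hp hq hgf hqp
  tfae_finish
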